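/- A \emph{weighted tree} $(T,w)$ is a partially ordered set $(T,\preceq)$ with exactly one minimal element $r$ (the root), in which every lower set ${\downarrow}t=\{x\in T:x\preceq t\}$ is finite and linearly ordered, together with a function $w:T\to[0,\infty)$, $t\mapsto w_t$, such that $w_t=0$ if and only if $t=r$. It is \emph{precompact} if for every $\varepsilon>0$ there is a finite set $F\subseteq T$ such that $\sum_{x\in L}w_x<\varepsilon$ for every finite linearly ordered set $L\subseteq T\setminus F$. For a weighted tree $(T,w)$ let $$T_w=\{(r,0)\}\cup\bigcup_{t\in T}\{t\}\times(0,w_t],$$ let $\partial T_w$ be the set of all infinite maximal linearly ordered subsets $b\subseteq T$ with $\sum_{t\in b}w_t<\infty$, and let $\overline T_w=T_w\cup\partial T_w$. Let $\bar d_w$ be the metric on $\overline T_w$ which is given, for $(x,x'),(y,y')\in T_w$ and $b,c\in\partial T_w$, by symmetry and $$\bar d_w((x,x'),(y,y'))=\begin{cases}|x'-y'|&\text{if }x=y,\\ (w_x-x')+(y'-w_y)+\sum_{t\in{\downarrow}y\setminus{\downarrow}x}w_t&\text{if }x\prec y,\\ (x'-w_x)+(y'-w_y)+\sum_{t\in{\downarrow}x\triangle{\downarrow}y}w_t&\text{if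 }x,y\text{ are incomparable,}\end{cases}$$ $$\bar d_w((x,x'),b)=\begin{cases}(w_x-x')+\sum_{t\in b\setminus{\downarrow}x}w_t&\text{if }x\in b,\\ (x'-w_x)+\sum_{t\in{\downarrow}x\triangle b}w_t&\text{if }x\notin b,\end{cases}\qquad \bar d_w(b,c)=\sum_{t\in b\triangle c}w_t,$$ where $\triangle$ is the symmetric difference; let $T_w$ carry the restriction of $\bar d_w$. A metric space $X$ is an \emph{$\mathbb R$-tree} if for all $x,y\in X$ the metric segment $[x,y]=\{z\in X:d(x,y)=d(x,z)+d(z,y)\}$ is isometric to the real interval $[0,d(x,y)]$, and $d(x,z)=d(x,y)+d(y,z)$ for all $x,y,z\in X$ with $[x,y]\cap[y,z]=\{y\}$. A metric space $X$ is \emph{injective} if every $1$-Lipschitz map $B\to X$ defined on a subspace $B$ of a metric space $A$ extends to a $1$-Lipschitz map $A\to X$. \textbf{Corollary.} For every weighted tree $(T,w)$, the metric space $\overline T_w$ is a completion of $T_w$ (it is complete and contains $T_w$ as a dense subspace), and (1) the complete metric space $\overline T_w$ is an $\mathbb R$-tree and is an injective metric space; (2) $\overline T_w$ is compact if and only if the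 weighted tree $(T,w)$ is precompact; (3) $\overline T_w$ is separable if and only if $T$ is countable. -/

import Mathlib

universe u v

/-- A forest: a partially ordered set all of whose lower sets `{x | x ≤ t}` are finite and
linearly ordered. -/
structure IsForest (T : Type u) [PartialOrder T] : Prop where
  finite_Iic : ∀ t : T, (Set.Iic t).Finite
  isChain_Iic : ∀ t : T, IsChain (· ≤ ·) (Set.Iic t)

/-- A weighted tree on the partially ordered set `T`: `T` is a tree, i.e. a forest with exactly
one minimal element (the root), and `weight : T → [0, ∞)` vanishes exactly at the root. -/
structure WeightedTree (T : Type u) [PartialOrder T] where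
  isForest : IsForest T
  root : T
  setOf_isMin_eq : {t : T | IsMin t} = {root}
  weight : T → ℝ
  weight_nonneg : ∀ t, 0 ≤ weight t
  weight_eq_zero_iff : ∀ t, weight t = 0 ↔ t = root

/-- The metric segment `[x, y]`. -/
def metricSegment {X : Type u} [MetricSpace X] (x y : X) : Set X :=
  {z | dist x y = dist x z + dist z y}

/-- An `ℝ`-tree: every metric segment `[x, y]` is isometric to the real interval
`[0, dist x y]`, and `[x, y] ∩ [y, z] = {y}` implies `dist x z = dist x y + dist y z`. -/
structure IsRTree (X : Type u) [MetricSpace X] : Prop where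
  isometric_segment : ∀ x y : X,
    Nonempty (metricSegment x y ≃ᵢ Set.Icc (0 : ℝ) (dist x y))
  dist_eq_add : ∀ x y z : X, metricSegment x y ∩ metricSegment y z = {y} →
    dist x z = dist x y + dist y z

/-- An injective metric space: every `1`-Lipschitz map into `X` from a subspace `B` of a metric
space `A` extends to a `1`-Lipschitz map on `A`. The spaces `A` range over a universe `v` that is
unrelated to that of `X`. -/
def IsInjectiveMetricSpace.{v', u'} (X : Type u') [MetricSpace X] : Prop :=
  ∀ (A : Type v') [MetricSpace A] (B : Set A) (f : B → X), LipschitzWith 1 f →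
    ∃ g : A → X, LipschitzWith 1 g ∧ ∀ b : B, g b = f b

namespace WeightedTree

variable {T : Type u} [PartialOrder T]

/-- `(T, w)` is precompact: for every `ε > 0` there is a finite `F ⊆ T` such that every finite
linearly ordered `L ⊆ T \ F` has total weight `< ε`. -/
def IsPrecompact (W : WeightedTree T) : Prop :=
  ∀ ε : ℝ, 0 < ε → ∃ F : Finset T, ∀ L : Finset T,
    IsChain (· ≤ ·) (L : Set T) → (∀ x ∈ L, x ∉ F) → ∑ x ∈ L, W.weight x < ε

/-- The set `T_w = {(r, 0)} ∪ ⋃ₜ {t} × (0, w t]`. -/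
@[ext] structure RTree (W : WeightedTree T) where
  node : T
  height : ℝ
  mem : (node = W.root ∧ height = 0) ∨ (0 < height ∧ height ≤ W.weight node)

/-- The set `∂T_w` of infinite branches (maximal chains) of `T` with finite total weight. -/
@[ext] structure FiniteWeightBranch (W : WeightedTree T) where
  carrier : Set T
  isMaxChain : IsMaxChain (· ≤ ·) carrier
  infinite : carrier.Infinite
  summable : Summable (fun t : carrier => W.weight t)

/-- The disjoint union of `T_w` and `∂T_w`. -/
inductive RTreeCompletion (W : WeightedTree T) where
  | point (p : RTree W)
  | branch (b : FiniteWeightBranch W)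

/-- The total weight of a set of vertices (only used for sets of finite total weight). -/
noncomputable def sumOn (W : WeightedTree T) (A : Set T) : ℝ := ∑' t : A, W.weight t

open Classical in
/-- The metric of `T_w`: the point `(t, t')` lies on the edge of length `w t` that joins the
immediate predecessor of `t` to `t`, at distance `t'` from the predecessor. -/
noncomputable def pointDist (W : WeightedTree T) (p q : RTree W) : ℝ :=
  if p.node = q.node then |p.height - q.height|
  else if p.node < q.node then
    (W.weight p.node - p.height) + (q.height - W.weight q.node)
      + W.sumOn (Set.Iic q.node \ Set.Iic p.node)
  else if q.node < p.node then
    (p.height - W.weight p.node) + (W.weight q.node - q.height)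
      + W.sumOn (Set.Iic p.node \ Set.Iic q.node)
  else
    (p.height - W.weight p.node) + (q.height - W.weight q.node)
      + W.sumOn (symmDiff (Set.Iic p.node) (Set.Iic q.node))

open Classical in
/-- The distance from a point of `T_w` to an infinite branch. -/
noncomputable def pointBranchDist (W : WeightedTree T) (p : RTree W)
    (b : FiniteWeightBranch W) : ℝ :=
  if p.node ∈ b.carrier then
    (W.weight p.node - p.height) + W.sumOn (b.carrier \ Set.Iic p.node)
  else
    (p.height - W.weight p.node) + W.sumOn (symmDiff (Set.Iic p.node) b.carrier)

/-- The extended metric on `T_w ∪ ∂T_w`. -/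
noncomputable def completionDist (W : WeightedTree T) :
    RTreeCompletion W → RTreeCompletion W → ℝ
  | .point p, .point q => W.pointDist p q
  | .point p, .branch b => W.pointBranchDist p b
  | .branch b, .point p => W.pointBranchDist p b
  | .branch b, .branch b' => W.sumOn (symmDiff b.carrier b'.carrier)

/-! Verification of the axioms of a metric, through the coordinates of a point: the length of the
part of each edge that the path from the root to the point covers. -/

variable {W : WeightedTree T}

theorem root_le (W : WeightedTree T) (t : T) : W.root ≤ t := by
  obtain ⟨m, hm, hmin⟩ := (W.isForest.finite_Iic t).exists_minimal ⟨t, le_refl t⟩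
  have : m ∈ {t : T | IsMin t} := fun s hs => hmin (hs.trans hm) hs
  rw [W.setOf_isMin_eq] at this
  rw [← (this : m = W.root)]
  exact hm

theorem RTree.height_nonneg (p : RTree W) : 0 ≤ p.height := by
  rcases p.mem with h | h
  · exact h.2.ge
  · exact h.1.le

theorem RTree.height_le (p : RTree W) : p.height ≤ W.weight p.node := by
  rcases p.mem with h | h
  · rw [h.2]; exact W.weight_nonneg _
  · exact h.2

theorem FiniteWeightBranch.mem_of_forall (b : FiniteWeightBranch W) {t : T}
    (h : ∀ s ∈ b.carrier, t ≤ s ∨ s ≤ t) : t ∈ b.carrier := by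
  have hc : IsChain (· ≤ ·) (insert t b.carrier) :=
    b.isMaxChain.1.insert fun s hs _ => h s hs
  rw [b.isMaxChain.2 hc (Set.subset_insert _ _)]
  exact Set.mem_insert _ _

theorem FiniteWeightBranch.mem_of_le (b : FiniteWeightBranch W) {s t : T} (hst : s ≤ t)
    (ht : t ∈ b.carrier) : s ∈ b.carrier := by
  refine b.mem_of_forall fun r hr => ?_
  rcases b.isMaxChain.1.total hr ht with h | h
  · exact (W.isForest.isChain_Iic t).total hst h
  · exact Or.inl (hst.trans h)

open Classical in
noncomputable def coord (W : WeightedTree T) : RTreeCompletion W → T → ℝ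
  | .point p, t => if t = p.node then p.height else if t < p.node then W.weight t else 0
  | .branch b, t => if t ∈ b.carrier then W.weight t else 0

def support (W : WeightedTree T) : RTreeCompletion W → Set T
  | .point p => Set.Iic p.node
  | .branch b => b.carrier

theorem hasSum_sumOn {A : Set T} (h : Summable (A.indicator W.weight)) :
    HasSum (A.indicator W.weight) (W.sumOn A) := by
  have := h.hasSum
  rwa [← tsum_subtype] at this

theorem summable_support (x : RTreeCompletion W) :
    Summable ((W.support x).indicator W.weight) := by
  cases x with
  | point p =>
    have : Finite (W.support (.point p)) := (W.isForest.finite_Iic p.node).to_subtype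
    exact summable_subtype_iff_indicator.1 Summable.of_finite
  | branch b => exact summable_subtype_iff_indicator.1 b.summable

theorem summable_of_subset {A : Set T} (x y : RTreeCompletion W)
    (h : A ⊆ W.support x ∪ W.support y) : Summable (A.indicator W.weight) := by
  refine Summable.of_nonneg_of_le (fun t => Set.indicator_nonneg (fun t _ => W.weight_nonneg t) t)
    (fun t => ?_) ((summable_support x).add (summable_support y))
  have hw := W.weight_nonneg t
  by_cases hA : t ∈ A
  · rcases h hA with hx | hx <;> simp only [Set.indicator, hA, hx, if_true] <;> split_ifs <;> linarith
  · simp only [Set.indicator, hA, if_false]; split_ifs <;> linarith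

theorem coord_nonneg (x : RTreeCompletion W) (t : T) : 0 ≤ W.coord x t := by
  cases x with
  | point p =>
    have := p.height_nonneg
    have := W.weight_nonneg t
    simp only [coord]; split_ifs <;> linarith
  | branch b =>
    have := W.weight_nonneg t
    simp only [coord]; split_ifs <;> linarith

theorem summable_coord (x : RTreeCompletion W) : Summable (W.coord x) := by
  refine Summable.of_nonneg_of_le (coord_nonneg x) (fun t => ?_) (summable_support x)
  have hw := W.weight_nonneg t
  cases x with
  | point p =>
    have hp := p.height_le
    simp only [coord, support]
    by_cases h1 : t = p.node
    · subst h1; simpa using hp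
    · by_cases h2 : t < p.node
      · simp [h1, h2, h2.le]
      · simp only [h1, h2, if_false]
        exact Set.indicator_nonneg (s := Set.Iic p.node) (fun t _ => W.weight_nonneg t) t
  | branch b => simp only [coord, support, Set.indicator]; exact le_rfl

theorem hasSum_point_point (p q : RTree W) :
    HasSum (fun t => |W.coord (.point p) t - W.coord (.point q) t|) (W.pointDist p q) := by
  classical
  have key : ∀ A : Set T, A ⊆ Set.Iic p.node ∪ Set.Iic q.node → ∀ a b : ℝ,
      HasSum (fun t => (if t = p.node then a else 0) + (if t = q.node then b else 0)
        + A.indicator W.weight t) (a + b + W.sumOn A) := fun A hA a b =>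
    ((hasSum_ite_eq p.node a).add (hasSum_ite_eq q.node b)).add
      (hasSum_sumOn (summable_of_subset (.point p) (.point q) hA))
  have hp := p.height_le
  have hq := q.height_le
  have hp0 := p.height_nonneg
  have hq0 := q.height_nonneg
  unfold pointDist
  split_ifs with h1 h2 h3
  · convert hasSum_ite_eq p.node (|p.height - q.height|) using 2 with t
    simp only [coord, ← h1]
    split_ifs <;> simp
  · convert key (Set.Iic q.node \ Set.Iic p.node) (fun t ht => Or.inr ht.1) _ _ using 2 with t
    have hw := W.weight_nonneg t
    simp only [coord, Set.indicator, Set.mem_sdiff, Set.mem_Iic]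
    by_cases a : t = p.node
    · subst a
      simp only [h1, h2, if_true, if_false, le_refl, not_true, and_false]
      rw [abs_of_nonpos (by linarith)]; ring
    · by_cases b : t = q.node
      · subst b
        simp only [a, h2.not_gt, h2.not_ge, if_true, if_false, le_refl, not_false_eq_true, and_true]
        rw [zero_sub, abs_neg, abs_of_nonneg hq0]; ring
      · by_cases c : t < p.node
        · simp [a, b, c, c.trans h2, c.le]
        · have c' : ¬ t ≤ p.node := fun h => c (lt_of_le_of_ne h a)
          by_cases d : t < q.node
          · simp [a, b, c, c', d, d.le, abs_of_nonneg hw]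
          · have d' : ¬ t ≤ q.node := fun h => d (lt_of_le_of_ne h b)
            simp [a, b, c, c', d, d']
  · convert key (Set.Iic p.node \ Set.Iic q.node) (fun t ht => Or.inl ht.1) _ _ using 2 with t
    have hw := W.weight_nonneg t
    simp only [coord, Set.indicator, Set.mem_sdiff, Set.mem_Iic]
    by_cases b : t = q.node
    · subst b
      simp only [Ne.symm h1, h3, if_true, if_false, le_refl, not_true, and_false]
      rw [abs_of_nonneg (by linarith)]; ring
    · by_cases a : t = p.node
      · subst a
        simp only [b, h3.not_gt, h3.not_ge, if_true, if_false, le_refl, not_false_eq_true, and_true]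
        rw [sub_zero, abs_of_nonneg hp0]; ring
      · by_cases c : t < q.node
        · simp [a, b, c, c.trans h3, c.le]
        · have c' : ¬ t ≤ q.node := fun h => c (lt_of_le_of_ne h b)
          by_cases d : t < p.node
          · simp [a, b, c, c', d, d.le, abs_of_nonneg hw]
          · have d' : ¬ t ≤ p.node := fun h => d (lt_of_le_of_ne h a)
            simp [a, b, c, c', d, d']
  · have h2' : ¬ p.node ≤ q.node := fun h => h2 (lt_of_le_of_ne h h1)
    have h3' : ¬ q.node ≤ p.node := fun h => h3 (lt_of_le_of_ne h (Ne.symm h1))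
    convert key (symmDiff (Set.Iic p.node) (Set.Iic q.node))
      (fun t ht => ht.elim (fun h => Or.inl h.1) fun h => Or.inr h.1) _ _ using 2 with t
    have hw := W.weight_nonneg t
    simp only [coord, Set.indicator, Set.mem_symmDiff, Set.mem_Iic]
    by_cases a : t = p.node
    · subst a
      simp [h1, h2, h2', abs_of_nonneg hp0]
    · by_cases b : t = q.node
      · subst b
        simp [a, h3, h3', abs_of_nonneg hq0]
      · have ea : t ≤ p.node ↔ t < p.node := ⟨fun h => lt_of_le_of_ne h a, le_of_lt⟩
        have eb : t ≤ q.node ↔ t < q.node := ⟨fun h => lt_of_le_of_ne h b, le_of_lt⟩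
        by_cases c : t < p.node <;> by_cases d : t < q.node <;>
          simp [a, b, c, d, ea, eb, abs_of_nonneg hw]

theorem hasSum_point_branch (p : RTree W) (B : FiniteWeightBranch W) :
    HasSum (fun t => |W.coord (.point p) t - W.coord (.branch B) t|)
      (W.pointBranchDist p B) := by
  classical
  have key : ∀ A : Set T, A ⊆ Set.Iic p.node ∪ B.carrier → ∀ a : ℝ,
      HasSum (fun t => (if t = p.node then a else 0)
        + A.indicator W.weight t) (a + W.sumOn A) := fun A hA a =>
    (hasSum_ite_eq p.node a).add
      (hasSum_sumOn (summable_of_subset (.point p) (.branch B) hA))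
  have hp := p.height_le
  have hp0 := p.height_nonneg
  unfold pointBranchDist
  split_ifs with h1
  · convert key (B.carrier \ Set.Iic p.node) (fun t ht => Or.inr ht.1) _ using 2 with t
    have hw := W.weight_nonneg t
    simp only [coord, Set.indicator, Set.mem_sdiff, Set.mem_Iic]
    by_cases a : t = p.node
    · subst a
      simp only [h1, if_true, if_false, le_refl, not_true, and_false]
      rw [abs_of_nonpos (by linarith)]; ring
    · have ea : t ≤ p.node ↔ t < p.node := ⟨fun h => lt_of_le_of_ne h a, le_of_lt⟩
      by_cases c : t < p.node
      · simp [a, c, ea, B.mem_of_le c.le h1]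
      · by_cases d : t ∈ B.carrier <;> simp [a, c, d, ea, abs_of_nonneg hw]
  · convert key (symmDiff (Set.Iic p.node) B.carrier)
      (fun t ht => ht.elim (fun h => Or.inl h.1) fun h => Or.inr h.1) _ using 2 with t
    have hw := W.weight_nonneg t
    simp only [coord, Set.indicator, Set.mem_symmDiff, Set.mem_Iic]
    by_cases a : t = p.node
    · subst a
      simp [h1, abs_of_nonneg hp0]
    · have ea : t ≤ p.node ↔ t < p.node := ⟨fun h => lt_of_le_of_ne h a, le_of_lt⟩
      by_cases c : t < p.node <;> by_cases d : t ∈ B.carrier <;>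
        simp [a, c, d, ea, abs_of_nonneg hw]

/-- The distance is the `ℓ¹`-distance of the coordinates. -/
theorem hasSum_completionDist (x y : RTreeCompletion W) :
    HasSum (fun t => |W.coord x t - W.coord y t|) (W.completionDist x y) := by
  classical
  cases x with
  | point p =>
    cases y with
    | point q => exact hasSum_point_point p q
    | branch b => exact hasSum_point_branch p b
  | branch b =>
    cases y with
    | point q =>
      have h := hasSum_point_branch q b
      simp only [abs_sub_comm] at h ⊢
      exact h
    | branch b' =>
      change HasSum _ (W.sumOn (symmDiff b.carrier b'.carrier))
      convert hasSum_sumOn (summable_of_subset (A := symmDiff b.carrier b'.carrier) (.branch b) (.branch b')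
        (fun t ht => ht.elim (fun h => Or.inl h.1) fun h => Or.inr h.1)) using 2 with t
      have hw := W.weight_nonneg t
      simp only [coord, Set.indicator, Set.mem_symmDiff]
      by_cases c : t ∈ b.carrier <;> by_cases d : t ∈ b'.carrier <;>
        simp [c, d, abs_of_nonneg hw]

theorem mem_support_iff (x : RTreeCompletion W) (t : T) :
    t ∈ W.support x ↔ t = W.root ∨ 0 < W.coord x t := by
  have pos : t ≠ W.root → 0 < W.weight t := fun h =>
    lt_of_le_of_ne (W.weight_nonneg t) fun h' => h ((W.weight_eq_zero_iff t).1 h'.symm)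
  cases x with
  | point p =>
    simp only [support, coord, Set.mem_Iic]
    constructor
    · intro h
      by_cases hr : t = W.root
      · exact Or.inl hr
      · right
        by_cases a : t = p.node
        · subst a
          simp only [if_true]
          rcases p.mem with h' | h'
          · exact absurd h'.1 hr
          · exact h'.1
        · simpa [a, lt_of_le_of_ne h a] using pos hr
    · rintro (rfl | h)
      · exact W.root_le _
      · split_ifs at h with h1 h2
        · exact h1.le
        · exact h2.le
        · exact absurd h (lt_irrefl _)
  | branch b =>
    simp only [support, coord]
    constructor
    · intro h
      by_cases hr : t = W.root
      · exact Or.inl hr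
      · right; simpa [h] using pos hr
    · rintro (rfl | h)
      · exact b.mem_of_forall fun s _ => Or.inl (W.root_le s)
      · by_contra h'
        simp [h'] at h

theorem coord_injective : Function.Injective (W.coord) := by
  intro x y h
  have hs : W.support x = W.support y := by
    ext t; rw [mem_support_iff, mem_support_iff, h]
  cases x with
  | point p =>
    cases y with
    | point q =>
      have e : p.node = q.node := Set.Iic_injective hs
      have := congrFun h p.node
      simp only [coord, e, if_true] at this
      rw [RTree.ext e this]
    | branch b =>
      have e : Set.Iic p.node = b.carrier := hs
      exact absurd (e ▸ W.isForest.finite_Iic p.node) b.infinite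
  | branch b =>
    cases y with
    | point q =>
      have e : b.carrier = Set.Iic q.node := hs
      exact absurd (e ▸ W.isForest.finite_Iic q.node) b.infinite
    | branch b' => rw [FiniteWeightBranch.ext hs]

/-- The metric space `T_w ∪ ∂T_w`. -/
noncomputable instance (W : WeightedTree T) : MetricSpace (RTreeCompletion W) where
  dist := W.completionDist
  dist_self x := (hasSum_completionDist x x).unique (by simp [hasSum_zero])
  dist_comm x y := (hasSum_completionDist x y).unique
    (by simpa only [abs_sub_comm] using hasSum_completionDist y x)
  dist_triangle x y z := hasSum_le (fun t => abs_sub_le _ _ _) (hasSum_completionDist x z)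
    ((hasSum_completionDist x y).add (hasSum_completionDist y z))
  eq_of_dist_eq_zero {x y} h := by
    have hs := hasSum_completionDist x y
    rw [show W.completionDist x y = 0 from h,
      hasSum_zero_iff_of_nonneg (fun t => abs_nonneg _)] at hs
    exact coord_injective (funext fun t => sub_eq_zero.1 (abs_eq_zero.1 (congrFun hs t)))

/-- The metric space `T_w`. -/
noncomputable instance (W : WeightedTree T) : MetricSpace (RTree W) where
  dist := W.pointDist
  dist_self p := dist_self (RTreeCompletion.point p)
  dist_comm p q := dist_comm (RTreeCompletion.point p) (RTreeCompletion.point q)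
  dist_triangle p q r :=
    dist_triangle (RTreeCompletion.point p) (RTreeCompletion.point q) (RTreeCompletion.point r)
  eq_of_dist_eq_zero {p q} h :=
    RTreeCompletion.point.inj (dist_eq_zero (x := RTreeCompletion.point p)
      (y := RTreeCompletion.point q) |>.1 h)

end WeightedTree

namespace WeightedTree

variable {T : Type u} [PartialOrder T] {W : WeightedTree T}

/-! `coord` embeds the space isometrically into `ℓ¹(T)`, and `exists_coord_eq` identifies the image:
summable functions between `0` and the weight, positive only on a chain, and with full weight
strictly below every positive coordinate. These conditions survive pointwise limits, minima and
medians, which gives completeness (`completeSpace`), a meet and `exists_median`. Paths from the root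
are the down-sets of the coordinatewise order. They are chains (`total_of_le`) on which the distance
is the difference of heights `rootDist`, every height below that of the endpoint occurs
(`exists_point_le`), and in general the distance is the sum of the heights minus twice the height of
the meet (`dist_eq_rootDist`). A segment therefore descends from one end to the meet and climbs to
the other, which yields the `ℝ`-tree axioms. For injectivity, each value `f b` is moved towards the
root by `dist a b`. For fixed `a` the resulting points form a chain, and its least upper bound is
the value of the extension at `a`. Precompactness says that the `ℓ¹`-tails are uniformly small, the
usual criterion for total boundedness. Separability is decided by the open edges, which are disjoint
open sets. -/

theorem coord_le_weight (x : RTreeCompletion W) (t : T) : W.coord x t ≤ W.weight t := by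
  have hw := W.weight_nonneg t
  cases x with
  | point p =>
    have hp := p.height_le
    simp only [coord]
    split_ifs with h1
    · exact h1 ▸ hp
    · exact le_rfl
    · exact hw
  | branch b => simp only [coord]; split_ifs <;> linarith

theorem comparable_of_coord_pos (x : RTreeCompletion W) {s t : T} (hs : 0 < W.coord x s)
    (ht : 0 < W.coord x t) : s ≤ t ∨ t ≤ s := by
  have hs' := (mem_support_iff x s).2 (Or.inr hs)
  have ht' := (mem_support_iff x t).2 (Or.inr ht)
  cases x with
  | point p => exact (W.isForest.isChain_Iic p.node).total hs' ht'
  | branch b => exact b.isMaxChain.1.total hs' ht'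

theorem coord_eq_weight_of_lt (x : RTreeCompletion W) {s t : T} (hst : s < t)
    (ht : 0 < W.coord x t) : W.coord x s = W.weight s := by
  have ht' := (mem_support_iff x t).2 (Or.inr ht)
  cases x with
  | point p =>
    have h : s < p.node := hst.trans_le ht'
    simp [coord, h, h.ne]
  | branch b => simp [coord, b.mem_of_le hst.le ht']

/-- The characterization of the coordinate functions of points of `T_w ∪ ∂T_w`. -/
theorem exists_coord_eq {c : T → ℝ} (hc0 : ∀ t, 0 ≤ c t) (hcw : ∀ t, c t ≤ W.weight t)
    (hsum : Summable c) (hchain : ∀ s t, 0 < c s → 0 < c t → s ≤ t ∨ t ≤ s)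
    (hlt : ∀ s t, s < t → 0 < c t → c s = W.weight s) : ∃ x, W.coord x = c := by
  classical
  set S : Set T := {t | t = W.root ∨ 0 < c t} with hS
  have hroot : W.root ∈ S := Or.inl rfl
  have hSchain : IsChain (· ≤ ·) S := by
    rintro s hs t ht -
    rcases hs with rfl | hs
    · exact Or.inl (W.root_le _)
    rcases ht with rfl | ht
    · exact Or.inr (W.root_le _)
    exact hchain s t hs ht
  have pos : ∀ t, t ≠ W.root → 0 < W.weight t := fun t h =>
    lt_of_le_of_ne (W.weight_nonneg t) fun h' => h ((W.weight_eq_zero_iff t).1 h'.symm)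
  have hdown : ∀ s t, s < t → t ∈ S → s ∈ S ∧ c s = W.weight s := by
    rintro s t hst (rfl | ht)
    · exact absurd (W.root_le s) hst.not_ge
    · have h := hlt s t hst ht
      refine ⟨?_, h⟩
      by_cases hs : s = W.root
      · exact Or.inl hs
      · exact Or.inr (h ▸ pos s hs)
  have hzero : ∀ t, t ∉ S → c t = 0 := fun t ht =>
    le_antisymm (not_lt.1 fun h => ht (Or.inr h)) (hc0 t)
  by_cases hfin : S.Finite
  · obtain ⟨m, hm, hmax⟩ := hfin.exists_maximal ⟨_, hroot⟩
    have hle : ∀ t ∈ S, t ≤ m := fun t ht => (hSchain.total ht hm).elim id fun h => hmax ht h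
    have hmem : (m = W.root ∧ c m = 0) ∨ (0 < c m ∧ c m ≤ W.weight m) := by
      rcases hm with h | h
      · exact Or.inl ⟨h, le_antisymm ((hcw m).trans ((W.weight_eq_zero_iff m).2 h).le) (hc0 m)⟩
      · exact Or.inr ⟨h, hcw m⟩
    refine ⟨.point ⟨m, c m, hmem⟩, funext fun t => ?_⟩
    simp only [coord]
    split_ifs with h1 h2
    · rw [h1]
    · exact (hdown t m h2 hm).2.symm
    · exact (hzero t fun h => h2 (lt_of_le_of_ne (hle t h) h1)).symm
  · have hnot : ∀ t, ¬ ∀ s ∈ S, s ≤ t := fun t h =>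
      hfin ((W.isForest.finite_Iic t).subset h)
    have hcS : ∀ t ∈ S, c t = W.weight t := by
      intro t ht
      by_contra hne
      refine hnot t fun s hs => ?_
      rcases hSchain.total hs ht with h | h
      · exact h
      · rcases h.eq_or_lt with rfl | h
        · exact le_rfl
        · exact absurd (hdown t s h hs).2 hne
    have hmax : IsMaxChain (· ≤ ·) S := by
      refine ⟨hSchain, fun S' hS' hsub => hsub.antisymm fun t ht => ?_⟩
      by_contra htS
      refine hnot t fun s hs => ?_
      rcases hS'.total (hsub hs) ht with h | h
      · exact h
      · rcases h.eq_or_lt with rfl | h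
        · exact le_rfl
        · exact absurd (hdown t s h hs).1 htS
    refine ⟨.branch ⟨S, hmax, hfin, ?_⟩, funext fun t => ?_⟩
    · refine (hsum.subtype S).congr fun t => ?_
      exact hcS t.1 t.2
    · simp only [coord]
      split_ifs with h
      · exact (hcS t h).symm
      · exact (hzero t h).symm

/-! ### Completeness. -/

theorem abs_coord_sub_le_dist (x y : RTreeCompletion W) (t : T) :
    |W.coord x t - W.coord y t| ≤ dist x y :=
  le_hasSum (hasSum_completionDist x y) t fun _ _ => abs_nonneg _

theorem continuous_coord (t : T) : Continuous fun x : RTreeCompletion W => W.coord x t :=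
  (LipschitzWith.of_dist_le' (K := 1) fun x y => by
    simpa [Real.dist_eq] using abs_coord_sub_le_dist x y t).continuous

theorem sum_abs_coord_sub_le_dist (x y : RTreeCompletion W) (F : Finset T) :
    ∑ t ∈ F, |W.coord x t - W.coord y t| ≤ dist x y :=
  sum_le_hasSum F (fun _ _ => abs_nonneg _) (hasSum_completionDist x y)

theorem dist_le_of_forall_sum_le {x y : RTreeCompletion W} {r : ℝ}
    (h : ∀ F : Finset T, ∑ t ∈ F, |W.coord x t - W.coord y t| ≤ r) : dist x y ≤ r :=
  hasSum_le_of_sum_le (hasSum_completionDist x y) h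

/-- A Cauchy sequence converges coordinatewise, and the limit is again the coordinate function of a
point: a positive limit coordinate is positive along the sequence from some index on, so the chain
and full-weight conditions pass to the limit. Bounds on finite partial sums upgrade this to
convergence in the metric. -/
instance completeSpace (W : WeightedTree T) : CompleteSpace (RTreeCompletion W) := by
  refine Metric.complete_of_cauchySeq_tendsto fun u hu => ?_
  have hcau : ∀ t, CauchySeq fun n => W.coord (u n) t := fun t => by
    rw [Metric.cauchySeq_iff] at hu ⊢
    intro ε hε
    obtain ⟨N, hN⟩ := hu ε hε
    exact ⟨N, fun m hm n hn => (abs_coord_sub_le_dist _ _ t).trans_lt (hN m hm n hn)⟩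
  choose c hc using fun t => cauchySeq_tendsto_of_complete (hcau t)
  have hpos : ∀ t, 0 < c t → ∀ᶠ n in Filter.atTop, 0 < W.coord (u n) t := fun t ht =>
    (hc t).eventually (lt_mem_nhds ht)
  have hbound : ∀ ε > 0, ∃ N, ∀ n ≥ N, ∀ F : Finset T,
      ∑ t ∈ F, |W.coord (u n) t - c t| ≤ ε := by
    intro ε hε
    obtain ⟨N, hN⟩ := Metric.cauchySeq_iff.1 hu ε hε
    refine ⟨N, fun n hn F => ?_⟩
    refine le_of_tendsto (tendsto_finsetSum F fun t _ =>
      ((tendsto_const_nhds (x := W.coord (u n) t)).sub (hc t)).abs) ?_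
    filter_upwards [Filter.eventually_ge_atTop N] with m hm
    exact (sum_abs_coord_sub_le_dist _ _ F).trans (hN n hn m hm).le
  have hc0 : ∀ t, 0 ≤ c t := fun t =>
    ge_of_tendsto' (hc t) fun n => coord_nonneg _ _
  obtain ⟨x, rfl⟩ : ∃ x, W.coord x = c := by
    refine exists_coord_eq hc0 (fun t => le_of_tendsto' (hc t) fun n => coord_le_weight _ _)
      ?_ (fun s t hs ht => ?_) fun s t hst ht => ?_
    · obtain ⟨N, hN⟩ := hbound 1 one_pos
      have h1 : Summable fun t => |W.coord (u N) t - c t| :=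
        summable_of_sum_le (fun _ => abs_nonneg _) (hN N le_rfl)
      simpa using (summable_coord (u N)).sub h1.of_abs
    · obtain ⟨n, h1, h2⟩ := ((hpos s hs).and (hpos t ht)).exists
      exact comparable_of_coord_pos _ h1 h2
    · refine tendsto_nhds_unique (hc s) (tendsto_const_nhds.congr' ?_)
      filter_upwards [hpos t ht] with n hn
      exact (coord_eq_weight_of_lt _ hst hn).symm
  refine ⟨x, Metric.tendsto_atTop.2 fun ε hε => ?_⟩
  obtain ⟨N, hN⟩ := hbound (ε / 2) (half_pos hε)
  exact ⟨N, fun n hn => (dist_le_of_forall_sum_le (hN n hn)).trans_lt (half_lt_self hε)⟩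

/-! The order by coordinates: `x ≤ y` if `x` lies on the path from the root to `y`. -/

noncomputable instance (W : WeightedTree T) : PartialOrder (RTreeCompletion W) :=
  PartialOrder.lift W.coord coord_injective

theorem le_iff_coord {x y : RTreeCompletion W} : x ≤ y ↔ ∀ t, W.coord x t ≤ W.coord y t :=
  Iff.rfl

theorem exists_coord_eq_min (x y : RTreeCompletion W) :
    ∃ z, W.coord z = fun t => min (W.coord x t) (W.coord y t) := by
  refine exists_coord_eq (fun t => le_min (coord_nonneg _ _) (coord_nonneg _ _))
    (fun t => (min_le_left _ _).trans (coord_le_weight _ _)) ?_ (fun s t hs ht => ?_)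
    fun s t hst ht => ?_
  · exact Summable.of_nonneg_of_le (fun t => le_min (coord_nonneg _ _) (coord_nonneg _ _))
      (fun t => min_le_left _ _) (summable_coord x)
  · exact comparable_of_coord_pos x (lt_min_iff.1 hs).1 (lt_min_iff.1 ht).1
  · rw [coord_eq_weight_of_lt x hst (lt_min_iff.1 ht).1,
      coord_eq_weight_of_lt y hst (lt_min_iff.1 ht).2, min_self]

noncomputable instance (W : WeightedTree T) : SemilatticeInf (RTreeCompletion W) where
  inf x y := (exists_coord_eq_min x y).choose
  inf_le_left x y := by
    rw [le_iff_coord, (exists_coord_eq_min x y).choose_spec]; exact fun t => min_le_left _ _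
  inf_le_right x y := by
    rw [le_iff_coord, (exists_coord_eq_min x y).choose_spec]; exact fun t => min_le_right _ _
  le_inf x y z h1 h2 := by
    rw [le_iff_coord, (exists_coord_eq_min y z).choose_spec]; exact fun t => le_min (h1 t) (h2 t)

theorem coord_inf (x y : RTreeCompletion W) (t : T) :
    W.coord (x ⊓ y) t = min (W.coord x t) (W.coord y t) :=
  congrFun (exists_coord_eq_min x y).choose_spec t

/-- If `x` is larger at `s` and `y` at `t`, then both nodes are positive for `z`, hence comparable.
The point with the positive coordinate at the upper node has full weight at the lower one, so it
cannot be exceeded there. -/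
theorem total_of_le {x y z : RTreeCompletion W} (hx : x ≤ z) (hy : y ≤ z) : x ≤ y ∨ y ≤ x := by
  by_contra! h
  simp only [le_iff_coord, not_forall, not_le] at h
  obtain ⟨⟨s, hs⟩, t, ht⟩ := h
  have hs0 := (coord_nonneg y s).trans_lt hs
  have ht0 := (coord_nonneg x t).trans_lt ht
  rcases comparable_of_coord_pos z (hs0.trans_le (hx s)) (ht0.trans_le (hy t)) with h | h <;>
    rcases h.eq_or_lt with rfl | h
  · exact lt_asymm hs ht
  · exact hs.not_ge (coord_eq_weight_of_lt y h ht0 ▸ coord_le_weight x s)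
  · exact lt_asymm hs ht
  · exact ht.not_ge (coord_eq_weight_of_lt x h hs0 ▸ coord_le_weight y t)

/-- The distance to the root. -/
noncomputable def rootDist (W : WeightedTree T) (x : RTreeCompletion W) : ℝ := ∑' t, W.coord x t

theorem hasSum_rootDist (x : RTreeCompletion W) : HasSum (W.coord x) (W.rootDist x) :=
  (summable_coord x).hasSum

theorem rootDist_nonneg (x : RTreeCompletion W) : 0 ≤ W.rootDist x :=
  tsum_nonneg (coord_nonneg x)

theorem rootDist_mono {x y : RTreeCompletion W} (h : x ≤ y) : W.rootDist x ≤ W.rootDist y :=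
  hasSum_le h (hasSum_rootDist x) (hasSum_rootDist y)

/-- Termwise, `|a - b| = a + b - 2 * min a b`. -/
theorem dist_eq_rootDist (x y : RTreeCompletion W) :
    dist x y = W.rootDist x + W.rootDist y - 2 * W.rootDist (x ⊓ y) := by
  refine (hasSum_completionDist x y).unique ?_
  have h := ((hasSum_rootDist x).add (hasSum_rootDist y)).sub
    ((hasSum_rootDist (x ⊓ y)).mul_left 2)
  refine (congrArg (HasSum · _) (funext fun t => ?_)).mpr h
  rw [coord_inf]
  rcases le_total (W.coord x t) (W.coord y t) with h | h
  · rw [min_eq_left h, abs_of_nonpos (by linarith)]; ring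
  · rw [min_eq_right h, abs_of_nonneg (by linarith)]; ring

theorem dist_eq_of_le {x y : RTreeCompletion W} (h : x ≤ y) :
    dist x y = W.rootDist y - W.rootDist x := by
  rw [dist_eq_rootDist, inf_eq_left.2 h]; ring

theorem abs_rootDist_sub_le (x y : RTreeCompletion W) :
    |W.rootDist x - W.rootDist y| ≤ dist x y := by
  have h1 := rootDist_mono (inf_le_left : x ⊓ y ≤ x)
  have h2 := rootDist_mono (inf_le_right : x ⊓ y ≤ y)
  rw [dist_eq_rootDist, abs_le]
  constructor <;> linarith

theorem continuous_rootDist (W : WeightedTree T) : Continuous W.rootDist :=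
  (LipschitzWith.of_dist_le' (K := 1) fun x y => by
    simpa [Real.dist_eq] using abs_rootDist_sub_le x y).continuous

theorem eq_of_le_of_rootDist_le {x y : RTreeCompletion W} (h : x ≤ y)
    (h' : W.rootDist y ≤ W.rootDist x) : x = y :=
  dist_le_zero.1 (by rw [dist_eq_of_le h]; linarith)

theorem le_iff_of_le {x y z : RTreeCompletion W} (hx : x ≤ z) (hy : y ≤ z) :
    x ≤ y ↔ W.rootDist x ≤ W.rootDist y := by
  refine ⟨rootDist_mono, fun h => (total_of_le hx hy).elim id fun h' => ?_⟩
  exact (eq_of_le_of_rootDist_le h' h).ge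

theorem dist_eq_abs_of_le {x y z : RTreeCompletion W} (hx : x ≤ z) (hy : y ≤ z) :
    dist x y = |W.rootDist x - W.rootDist y| := by
  rcases total_of_le hx hy with h | h
  · have := rootDist_mono h
    rw [dist_eq_of_le h, abs_of_nonpos (by linarith)]; ring
  · have := rootDist_mono h
    rw [dist_comm, dist_eq_of_le h, abs_of_nonneg (by linarith)]

def rootPoint (W : WeightedTree T) : RTree W := ⟨W.root, 0, Or.inl ⟨rfl, rfl⟩⟩

theorem coord_rootPoint (t : T) : W.coord (.point W.rootPoint) t = 0 := by
  by_cases h : t = W.root <;> simp [coord, rootPoint, (W.root_le t).not_gt, h]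

theorem rootPoint_le (x : RTreeCompletion W) : .point W.rootPoint ≤ x := fun t =>
  (coord_rootPoint t).trans_le (coord_nonneg x t)

theorem rootDist_rootPoint : W.rootDist (.point W.rootPoint) = 0 := by
  simp [rootDist, coord_rootPoint]

/-- The path from the root to `x` contains a point of `T_w` at each distance less than that
of `x`. -/
theorem exists_point_le (x : RTreeCompletion W) {s : ℝ} (hs0 : 0 ≤ s) (hs : s < W.rootDist x) :
    ∃ p : RTree W, .point p ≤ x ∧ W.rootDist (.point p) = s := by
  classical
  rcases hs0.eq_or_lt with rfl | hs0
  · exact ⟨W.rootPoint, rootPoint_le x, rootDist_rootPoint⟩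
  set I : T → Finset T := fun t => (W.isForest.finite_Iic t).toFinset with hI
  have hmemI : ∀ {u t}, u ∈ I t ↔ u ≤ t := by simp [hI]
  -- Some finite partial sum exceeds `s`; its positive terms lie on a chain, and `m` is the top of
  -- that chain.
  obtain ⟨m, hm⟩ : ∃ m, s ≤ ∑ u ∈ I m, W.coord x u := by
    obtain ⟨F, hF⟩ := ((hasSum_rootDist x).eventually (lt_mem_nhds hs)).exists
    set G := F.filter fun t => 0 < W.coord x t with hG
    have hFG : ∑ t ∈ F, W.coord x t = ∑ t ∈ G, W.coord x t := by
      refine (Finset.sum_filter_of_ne fun t _ h => ?_).symm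
      exact lt_of_le_of_ne (coord_nonneg x t) h.symm
    rw [hFG] at hF
    have hne : G.Nonempty := by
      by_contra h
      rw [Finset.not_nonempty_iff_eq_empty.1 h, Finset.sum_empty] at hF
      exact hF.not_gt hs0
    obtain ⟨m, hm⟩ := G.exists_maximal hne
    refine ⟨m, hF.le.trans (Finset.sum_le_sum_of_subset_of_nonneg (fun t ht => ?_)
      fun t _ _ => coord_nonneg x t)⟩
    rw [hmemI]
    rcases comparable_of_coord_pos x (Finset.mem_filter.1 ht).2
      (Finset.mem_filter.1 hm.1).2 with h | h
    · exact h
    · exact hm.2 ht h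
  -- `k` is the first node at which the length accumulated from the root reaches `s`. The sum `D`
  -- over the nodes strictly below `k` is then less than `s`, so the point sought lies on the edge
  -- of `k` at the positive height `s - D`.
  obtain ⟨k, hk⟩ := ((I m).filter fun t => s ≤ ∑ u ∈ I t, W.coord x u).exists_minimal
    ⟨m, Finset.mem_filter.2 ⟨hmemI.2 le_rfl, hm⟩⟩
  have hkm := hmemI.1 (Finset.mem_filter.1 hk.1).1
  have hks := (Finset.mem_filter.1 hk.1).2
  have hIk : insert k ((I k).erase k) = I k := Finset.insert_erase (hmemI.2 le_rfl)
  rw [← hIk, Finset.sum_insert (Finset.notMem_erase _ _)] at hks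
  set D := ∑ u ∈ (I k).erase k, W.coord x u with hD
  have hDs : D < s := by
    rcases ((I k).erase k).eq_empty_or_nonempty with h | h
    · rwa [hD, h, Finset.sum_empty]
    · obtain ⟨l, hl⟩ := ((I k).erase k).exists_maximal h
      have hlk : l < k := lt_of_le_of_ne (hmemI.1 (Finset.mem_of_mem_erase hl.1))
        (Finset.ne_of_mem_erase hl.1)
      have hsub : (I k).erase k ⊆ I l := fun u hu => by
        have huk := hmemI.1 (Finset.mem_of_mem_erase hu)
        rw [hmemI]
        exact ((W.isForest.isChain_Iic k).total huk hlk.le).elim id fun h => hl.2 hu h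
      by_contra! hcon
      have : l ∈ (I m).filter fun t => s ≤ ∑ u ∈ I t, W.coord x u :=
        Finset.mem_filter.2 ⟨hmemI.2 (hlk.le.trans hkm), hcon.trans
          (Finset.sum_le_sum_of_subset_of_nonneg hsub fun t _ _ => coord_nonneg x t)⟩
      exact hlk.not_ge (hk.2 this hlk.le)
  have hle : s - D ≤ W.coord x k := by linarith
  have hpos : 0 < W.coord x k := by linarith
  set p : RTree W := ⟨k, s - D, Or.inr ⟨by linarith, hle.trans (coord_le_weight x k)⟩⟩ with hp
  have hlt : ∀ t, t < k → W.coord (.point p) t = W.coord x t := fun t ht => by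
    rw [coord_eq_weight_of_lt x ht hpos]; simp [coord, hp, ht, ht.ne]
  have hpk : W.coord (.point p) k = s - D := by simp [coord, hp]
  have hzero : ∀ t, ¬ t ≤ k → W.coord (.point p) t = 0 := fun t ht => by
    have h1 : t ≠ k := fun h => ht h.le
    have h2 : ¬ t < k := fun h => ht h.le
    simp [coord, hp, h1, h2]
  refine ⟨p, fun t => ?_, ?_⟩
  · by_cases h : t ≤ k
    · rcases h.eq_or_lt with rfl | h
      · exact hpk.trans_le hle
      · exact (hlt t h).le
    · exact (hzero t h).trans_le (coord_nonneg x t)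
  · have h : HasSum (W.coord (.point p)) _ := hasSum_sum_of_ne_finset_zero (s := I k)
      fun t ht => hzero t fun h => ht (hmemI.2 h)
    rw [(hasSum_rootDist _).unique h, ← hIk, Finset.sum_insert (Finset.notMem_erase _ _), hpk,
      Finset.sum_congr rfl fun t ht => hlt t (lt_of_le_of_ne
        (hmemI.1 (Finset.mem_of_mem_erase ht)) (Finset.ne_of_mem_erase ht)), ← hD]
    ring

theorem exists_le_rootDist_eq (x : RTreeCompletion W) {s : ℝ} (hs0 : 0 ≤ s)
    (hs : s ≤ W.rootDist x) : ∃ z ≤ x, W.rootDist z = s := by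
  rcases hs.eq_or_lt with rfl | hs
  · exact ⟨x, le_rfl, rfl⟩
  · obtain ⟨p, hp⟩ := exists_point_le x hs0 hs
    exact ⟨_, hp⟩

theorem denseRange_point (W : WeightedTree T) :
    DenseRange (RTreeCompletion.point : RTree W → RTreeCompletion W) := by
  refine Metric.denseRange_iff.2 fun x ε hε => ?_
  rcases (rootDist_nonneg x).eq_or_lt with h | h
  · refine ⟨W.rootPoint, ?_⟩
    rw [dist_comm, dist_eq_of_le (rootPoint_le x), ← h, rootDist_rootPoint]
    simpa using hε
  · obtain ⟨p, hp, hp'⟩ := exists_point_le x (le_max_left 0 (W.rootDist x - ε / 2))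
      (max_lt h (by linarith))
    refine ⟨p, ?_⟩
    have := le_max_right 0 (W.rootDist x - ε / 2)
    rw [dist_comm, dist_eq_of_le hp, hp']
    linarith

/-! ### Metric segments, medians and the `ℝ`-tree axioms. -/

/-- The deficits in the termwise triangle inequalities are nonnegative, so their sum vanishes only
if each of them does. -/
theorem mem_metricSegment_iff_coord {x y z : RTreeCompletion W} :
    z ∈ metricSegment x y ↔ ∀ t,
      |W.coord x t - W.coord y t| = |W.coord x t - W.coord z t| + |W.coord z t - W.coord y t| := by
  have hxy : HasSum (fun t => |W.coord x t - W.coord y t|) (dist x y) := hasSum_completionDist x y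
  have hz : HasSum (fun t => |W.coord x t - W.coord z t| + |W.coord z t - W.coord y t|)
      (dist x z + dist z y) := (hasSum_completionDist x z).add (hasSum_completionDist z y)
  refine ⟨fun h t => ?_, fun h => hxy.unique ((funext h).symm ▸ hz)⟩
  have h0 := hz.sub hxy
  rw [show dist x y = dist x z + dist z y from h, sub_self, hasSum_zero_iff_of_nonneg
    fun t => sub_nonneg.2 (abs_sub_le _ _ _)] at h0
  exact (sub_eq_zero.1 (congrFun h0 t)).symm

theorem mem_metricSegment_iff {x y z : RTreeCompletion W} :
    z ∈ metricSegment x y ↔ x ⊓ y ≤ z ∧ (z ≤ x ∨ z ≤ y) := by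
  rw [mem_metricSegment_iff_coord]
  constructor
  · intro h
    have hmax : ∀ t, W.coord z t ≤ max (W.coord x t) (W.coord y t) := fun t => by
      have := h t
      by_contra! hlt
      rw [max_lt_iff] at hlt
      rw [abs_of_neg (a := W.coord x t - W.coord z t) (by linarith),
        abs_of_pos (a := W.coord z t - W.coord y t) (by linarith)] at this
      rcases abs_cases (W.coord x t - W.coord y t) with h | h <;> linarith
    refine ⟨fun t => ?_, ?_⟩
    · have := h t
      rw [coord_inf]
      by_contra! hlt
      rw [lt_min_iff] at hlt
      rw [abs_of_pos (a := W.coord x t - W.coord z t) (by linarith),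
        abs_of_neg (a := W.coord z t - W.coord y t) (by linarith)] at this
      rcases abs_cases (W.coord x t - W.coord y t) with h | h <;> linarith
    -- Suppose `z` exceeds `x` at `s` and `y` at `t`. Then `y` dominates `z` at `s` and `x`
    -- dominates `z` at `t`. The nodes are comparable, and whichever is lower, the point dominating
    -- at the upper one has full weight at the lower one, where it was supposed to be exceeded.
    · by_contra! hcon
      simp only [le_iff_coord, not_forall, not_le] at hcon
      obtain ⟨⟨s, hs⟩, t, ht⟩ := hcon
      have hs' := (le_max_iff.1 (hmax s)).resolve_left hs.not_ge
      have ht' := (le_max_iff.1 (hmax t)).resolve_right ht.not_ge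
      have hs0 := (coord_nonneg x s).trans_lt hs
      have ht0 := (coord_nonneg y t).trans_lt ht
      rcases comparable_of_coord_pos z hs0 ht0 with h | h <;> rcases h.eq_or_lt with rfl | h
      · linarith
      · exact hs.not_ge (coord_eq_weight_of_lt x h (ht0.trans_le ht') ▸ coord_le_weight z s)
      · linarith
      · exact ht.not_ge (coord_eq_weight_of_lt y h (hs0.trans_le hs') ▸ coord_le_weight z t)
  · rintro ⟨h1, h2⟩ t
    have h1 := h1 t
    rw [coord_inf, min_le_iff] at h1
    have h2 : W.coord z t ≤ W.coord x t ∨ W.coord z t ≤ W.coord y t :=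
      h2.imp (fun h => h t) fun h => h t
    grind

/-- The coordinatewise median works. It is positive at a node exactly when two of the three points
are; two such pairs share a point, which gives comparability, and both members of a pair have full
weight below the node, hence so does the median. -/
theorem exists_median (x y z : RTreeCompletion W) : ∃ m, m ∈ metricSegment x y ∧
    m ∈ metricSegment y z ∧ m ∈ metricSegment x z := by
  obtain ⟨m, hm⟩ : ∃ m, W.coord m = fun t => max (min (W.coord x t) (W.coord y t))
      (max (min (W.coord y t) (W.coord z t)) (min (W.coord x t) (W.coord z t))) := by
    have hpos : ∀ t, 0 < max (min (W.coord x t) (W.coord y t))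
        (max (min (W.coord y t) (W.coord z t)) (min (W.coord x t) (W.coord z t))) →
        (0 < W.coord x t ∧ 0 < W.coord y t) ∨ (0 < W.coord y t ∧ 0 < W.coord z t) ∨
          (0 < W.coord x t ∧ 0 < W.coord z t) := fun t ht => by
      simpa only [lt_max_iff, lt_min_iff] using ht
    refine exists_coord_eq (fun t => ?_) (fun t => ?_) ?_ (fun s t hs ht => ?_)
      fun s t hst ht => ?_
    · exact le_max_of_le_left (le_min (coord_nonneg _ _) (coord_nonneg _ _))
    · have := coord_le_weight x t
      have := coord_le_weight y t
      simp [*]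
    · refine Summable.of_nonneg_of_le (fun t => ?_) (fun t => ?_)
        ((summable_coord x).add (summable_coord y))
      · exact le_max_of_le_left (le_min (coord_nonneg _ _) (coord_nonneg _ _))
      · have hx := coord_nonneg x t
        have hy := coord_nonneg y t
        refine max_le ?_ (max_le ?_ ?_)
        · exact (min_le_left _ _).trans (by linarith)
        · exact (min_le_left _ _).trans (by linarith)
        · exact (min_le_left _ _).trans (by linarith)
    · have := comparable_of_coord_pos x (s := s) (t := t)
      have := comparable_of_coord_pos y (s := s) (t := t)
      have := comparable_of_coord_pos z (s := s) (t := t)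
      have := hpos s hs
      have := hpos t ht
      tauto
    · have hx := coord_le_weight x s
      have hy := coord_le_weight y s
      have hz := coord_le_weight z s
      rcases hpos t ht with ⟨h1, h2⟩ | ⟨h1, h2⟩ | ⟨h1, h2⟩ <;>
        rw [coord_eq_weight_of_lt _ hst h1, coord_eq_weight_of_lt _ hst h2] <;> simp [*]
  simp only [mem_metricSegment_iff_coord]
  refine ⟨m, fun t => ?_, fun t => ?_, fun t => ?_⟩ <;> rw [hm] <;> grind

theorem dist_eq_sub_of_mem_segment {x y z z' : RTreeCompletion W} (hz : x ⊓ y ≤ z) (hzx : z ≤ x)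
    (hz' : x ⊓ y ≤ z') (hzy : z' ≤ y) : dist z z' = dist x z' - dist x z := by
  have h1 : z ⊓ z' = x ⊓ y := le_antisymm (inf_le_inf hzx hzy) (le_inf hz hz')
  have h2 : x ⊓ z' = x ⊓ y := le_antisymm (inf_le_inf le_rfl hzy) (le_inf inf_le_left hz')
  rw [dist_comm x z, dist_eq_of_le hzx, dist_eq_rootDist, dist_eq_rootDist, h1, h2]
  ring

theorem isRTree (W : WeightedTree T) : IsRTree (RTreeCompletion W) where
  isometric_segment x y := by
    have hle : ∀ z ∈ metricSegment x y, dist x z ≤ dist x y := fun z hz => by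
      rw [show dist x y = dist x z + dist z y from hz]
      exact le_add_of_nonneg_right dist_nonneg
    let φ : metricSegment x y → Set.Icc (0 : ℝ) (dist x y) :=
      fun z => ⟨dist x z, dist_nonneg, hle z z.2⟩
    have hiso : Isometry φ := by
      refine Isometry.of_dist_eq ?_
      rintro ⟨z, hz⟩ ⟨z', hz'⟩
      change |dist x z - dist x z'| = dist z z'
      obtain ⟨h1, h2⟩ := mem_metricSegment_iff.1 hz
      obtain ⟨h1', h2'⟩ := mem_metricSegment_iff.1 hz'
      have key : ∀ {z z' : RTreeCompletion W}, x ⊓ y ≤ z → z ≤ x → x ⊓ y ≤ z' → z' ≤ y →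
          |dist x z - dist x z'| = dist z z' := fun h1 h2 h1' h2' => by
        have := dist_eq_sub_of_mem_segment h1 h2 h1' h2'
        rw [abs_sub_comm, ← this, abs_of_nonneg dist_nonneg]
      rcases h2 with h2 | h2 <;> rcases h2' with h2' | h2'
      · rw [dist_comm x z, dist_comm x z', dist_eq_of_le h2, dist_eq_of_le h2',
          dist_eq_abs_of_le h2 h2', abs_sub_comm]
        congr 1; ring
      · exact key h1 h2 h1' h2'
      · rw [abs_sub_comm, dist_comm z z']
        exact key h1' h2' h1 h2
      · have e1 := dist_eq_sub_of_mem_segment inf_le_left le_rfl h1 h2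
        have e2 : ∀ {z : RTreeCompletion W}, x ⊓ y ≤ z → z ≤ y → x ⊓ z = x ⊓ y :=
          fun h h' => le_antisymm (inf_le_inf le_rfl h') (le_inf inf_le_left h)
        rw [dist_eq_rootDist x z, dist_eq_rootDist x z', e2 h1 h2, e2 h1' h2',
          dist_eq_abs_of_le h2 h2']
        congr 1; ring
    refine ⟨⟨Equiv.ofBijective φ ⟨hiso.injective, ?_⟩, hiso⟩⟩
    rintro ⟨s, hs0, hs⟩
    have hd := dist_eq_rootDist x y
    have h0 := rootDist_nonneg (x ⊓ y)
    -- Up to the distance from `x` to the meet, the point is found below `x`; beyond that, below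
    -- `y`, at the height that solves the distance formula for `s`.
    rcases le_total s (W.rootDist x - W.rootDist (x ⊓ y)) with h | h
    · obtain ⟨z, hz, hzs⟩ := exists_le_rootDist_eq x (s := W.rootDist x - s)
        (by linarith) (by linarith)
      refine ⟨⟨z, mem_metricSegment_iff.2 ⟨?_, Or.inl hz⟩⟩, Subtype.ext ?_⟩
      · rw [le_iff_of_le inf_le_left hz]; linarith
      · change dist x z = s
        rw [dist_comm, dist_eq_of_le hz]; linarith
    · obtain ⟨z, hz, hzs⟩ := exists_le_rootDist_eq y
        (s := s - W.rootDist x + 2 * W.rootDist (x ⊓ y)) (by linarith) (by linarith)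
      have hiz : x ⊓ y ≤ z := by rw [le_iff_of_le inf_le_right hz]; linarith
      refine ⟨⟨z, mem_metricSegment_iff.2 ⟨hiz, Or.inr hz⟩⟩, Subtype.ext ?_⟩
      change dist x z = s
      rw [dist_eq_rootDist, show x ⊓ z = x ⊓ y from
        le_antisymm (inf_le_inf le_rfl hz) (le_inf inf_le_left hiz)]
      linarith
  dist_eq_add x y z h := by
    -- The median lies in both segments, so it is `y`; it also lies between `x` and `z`.
    obtain ⟨m, h1, h2, h3⟩ := exists_median x y z
    have : m = y := h.subset ⟨h1, h2⟩
    exact this ▸ h3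

/-! ### Injectivity. -/

theorem isClosed_Iic (x : RTreeCompletion W) : IsClosed (Set.Iic x) := by
  have : Set.Iic x = ⋂ t, {z | W.coord z t ≤ W.coord x t} := by
    ext z; simp [le_iff_coord]
  rw [this]
  exact isClosed_iInter fun t => isClosed_le (continuous_coord t) continuous_const

theorem isClosed_Ici (x : RTreeCompletion W) : IsClosed (Set.Ici x) := by
  have : Set.Ici x = ⋂ t, {z | W.coord x t ≤ W.coord z t} := by
    ext z; simp [le_iff_coord]
  rw [this]
  exact isClosed_iInter fun t => isClosed_le continuous_const (continuous_coord t)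

/-- A bounded chain has an upper bound in its closure. -/
theorem exists_upperBound_of_chain {ι : Type*} [Nonempty ι] (q : ι → RTreeCompletion W)
    (hq : ∀ i j, q i ≤ q j ∨ q j ≤ q i) {M : ℝ} (hM : ∀ i, W.rootDist (q i) ≤ M) :
    ∃ g, (∀ i, q i ≤ g) ∧ ∀ a < W.rootDist g, ∃ i, a < W.rootDist (q i) := by
  have hbdd : BddAbove (Set.range fun i => W.rootDist (q i)) := ⟨M, by rintro _ ⟨i, rfl⟩; exact hM i⟩
  obtain ⟨u, -, hu, hmem⟩ := exists_seq_tendsto_sSup (Set.range_nonempty _) hbdd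
  choose i hi using hmem
  -- On a chain, distance is difference of heights, so a sequence whose heights tend to the supremum
  -- is Cauchy.
  have hdist : ∀ j k, dist (q j) (q k) = dist (W.rootDist (q j)) (W.rootDist (q k)) := fun j k => by
    rcases hq j k with h | h
    · exact dist_eq_abs_of_le h le_rfl
    · exact dist_eq_abs_of_le le_rfl h
  have hcau : CauchySeq fun n => q (i n) := by
    have := hu.cauchySeq
    rw [Metric.cauchySeq_iff] at this ⊢
    simpa only [hdist, hi] using this
  obtain ⟨g, hg⟩ := cauchySeq_tendsto_of_complete hcau
  have hgs : W.rootDist g = sSup (Set.range fun i => W.rootDist (q i)) := by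
    refine tendsto_nhds_unique (((continuous_rootDist W).tendsto g).comp hg) ?_
    simpa only [Function.comp_def, hi] using hu
  refine ⟨g, fun j => ?_, fun a ha => ?_⟩
  -- Otherwise the sequence is eventually below `q j`, hence so is its limit; having the supremal
  -- height, the limit equals `q j`.
  · by_cases h : ∃ᶠ n in Filter.atTop, q j ≤ q (i n)
    · exact (isClosed_Ici (q j)).mem_of_frequently_of_tendsto h hg
    · have h' : ∀ᶠ n in Filter.atTop, q (i n) ∈ Set.Iic (q j) :=
        (Filter.not_frequently.1 h).mono fun n hn => (hq j (i n)).resolve_left hn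
      have hle : g ≤ q j := (isClosed_Iic (q j)).mem_of_tendsto hg h'
      exact (eq_of_le_of_rootDist_le hle (hgs ▸ le_csSup hbdd ⟨j, rfl⟩)).ge
  · rw [hgs] at ha
    obtain ⟨_, ⟨j, rfl⟩, hj⟩ := exists_lt_of_lt_csSup (Set.range_nonempty _) ha
    exact ⟨j, hj⟩

/-- If `p` were below `x ⊓ y`, then `p` and `q` would both lie below `y` and be comparable; so `x ⊓
y` lies below `p`, and likewise below `q`. -/
theorem inf_eq_inf_of_incomparable {p q x y : RTreeCompletion W} (hp : p ≤ x) (hq : q ≤ y)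
    (h1 : ¬ p ≤ q) (h2 : ¬ q ≤ p) : p ⊓ q = x ⊓ y := by
  refine le_antisymm (inf_le_inf hp hq) (le_inf ?_ ?_)
  · refine (total_of_le inf_le_left hp).elim id fun h => ?_
    exact ((total_of_le (h.trans inf_le_right) hq).elim h1 h2).elim
  · refine (total_of_le inf_le_right hq).elim id fun h => ?_
    exact ((total_of_le hp (h.trans inf_le_left)).elim h1 h2).elim

theorem rootDist_inf_lt {p q : RTreeCompletion W} (h : ¬ p ≤ q) :
    W.rootDist (p ⊓ q) < W.rootDist p := by
  by_contra! h'
  exact h (inf_eq_left.1 (eq_of_le_of_rootDist_le inf_le_left h'))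

theorem isInjectiveMetricSpace (W : WeightedTree T) :
    IsInjectiveMetricSpace.{v} (RTreeCompletion W) := by
  intro A _ B f hf
  have hf' : ∀ b c : B, dist (f b) (f c) ≤ dist (b : A) c := fun b c => by
    simpa [Subtype.dist_eq] using hf.dist_le_mul b c
  rcases isEmpty_or_nonempty B with hB | hB
  · exact ⟨fun _ => .point W.rootPoint, LipschitzWith.const' _, fun b => hB.elim b⟩
  -- `q a b` is reached from `f b` by moving `dist a b` towards the root and stopping there if the
  -- path is too short.
  have hq : ∀ (a : A) (b : B), ∃ z ≤ f b, W.rootDist z = max 0 (W.rootDist (f b) - dist a b) :=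
    fun a b => exists_le_rootDist_eq _ (le_max_left _ _)
      (max_le (rootDist_nonneg _) (sub_le_self _ dist_nonneg))
  choose q hqf hqd using hq
  have hlt : ∀ {a : A} {b : B} {x : RTreeCompletion W}, W.rootDist x < W.rootDist (q a b) →
      W.rootDist (q a b) = W.rootDist (f b) - dist a b := fun {a b x} h => by
    have h0 := (rootDist_nonneg x).trans_lt h
    rw [hqd] at h0 ⊢
    exact max_eq_right ((lt_max_iff.1 h0).resolve_left (lt_irrefl 0)).le
  -- Incomparable points would lie strictly above `f b ⊓ f c`, forcing `dist (f b) (f c)` to exceed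
  -- `dist a b + dist a c`.
  have hchain : ∀ a b c, q a b ≤ q a c ∨ q a c ≤ q a b := by
    intro a b c
    by_contra! h
    have e := inf_eq_inf_of_incomparable (hqf a b) (hqf a c) h.1 h.2
    have h1 := rootDist_inf_lt h.1
    have h2 := rootDist_inf_lt h.2
    rw [inf_comm] at h2
    have e1 := hlt h1
    have e2 := hlt h2
    rw [e] at h1 h2
    have h3 := hf' b c
    rw [dist_eq_rootDist] at h3
    have h4 := dist_triangle_left (b : A) c a
    linarith
  have hbound : ∀ (a : A) (b c : B), W.rootDist (q a b) ≤ W.rootDist (f c) + dist a c := by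
    intro a b c
    rw [hqd]
    have h1 := (abs_le.1 (abs_rootDist_sub_le (f b) (f c))).2
    have h2 := hf' b c
    have h3 := dist_triangle_left (b : A) c a
    exact max_le (add_nonneg (rootDist_nonneg _) dist_nonneg) (by linarith)
  choose g hqg hg using fun a =>
    exists_upperBound_of_chain (q a) (hchain a) fun b => hbound a b hB.some
  have hheight : ∀ a a', W.rootDist (g a) ≤ W.rootDist (g a') + dist a a' := by
    intro a a'
    refine le_of_forall_lt fun s hs => ?_
    obtain ⟨b, hb⟩ := hg a s hs
    refine hb.trans_le ?_
    have h1 := rootDist_mono (hqg a' b)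
    have h2 := dist_triangle_left a' (b : A) a
    rw [hqd] at h1 ⊢
    have h3 := max_le_iff.1 h1
    have h4 := dist_nonneg (x := a) (y := a')
    exact max_le (by linarith) (by linarith)
  refine ⟨g, LipschitzWith.of_dist_le_mul fun a a' => ?_, fun b => ?_⟩
  · rw [NNReal.coe_one, one_mul]
    by_cases h1 : g a ≤ g a'
    · rw [dist_eq_of_le h1]
      have := hheight a' a
      rw [dist_comm] at this
      linarith
    by_cases h2 : g a' ≤ g a
    · rw [dist_comm, dist_eq_of_le h2]
      have := hheight a a'
      linarith
    have l1 := rootDist_inf_lt h1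
    have l2 := rootDist_inf_lt h2
    rw [inf_comm] at l2
    refine le_of_forall_pos_le_add fun ε hε => ?_
    -- `q a b` and `q a' c` are chosen above the height of the meet, which makes them incomparable
    -- and gives `g a ⊓ g a' = f b ⊓ f c`, and within `ε / 2` of the heights of `g a` and `g a'`.
    obtain ⟨b, hb⟩ := hg a (max (W.rootDist (g a ⊓ g a')) (W.rootDist (g a) - ε / 2))
      (max_lt l1 (by linarith))
    obtain ⟨c, hc⟩ := hg a' (max (W.rootDist (g a ⊓ g a')) (W.rootDist (g a') - ε / 2))
      (max_lt l2 (by linarith))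
    rw [max_lt_iff] at hb hc
    have n1 : ¬ q a b ≤ q a' c := fun h =>
      hb.1.not_ge (rootDist_mono (le_inf (hqg a b) (h.trans (hqg a' c))))
    have n2 : ¬ q a' c ≤ q a b := fun h =>
      hc.1.not_ge (rootDist_mono (le_inf (h.trans (hqg a b)) (hqg a' c)))
    have e : g a ⊓ g a' = f b ⊓ f c :=
      (inf_eq_inf_of_incomparable (hqg a b) (hqg a' c) n1 n2).symm.trans
        (inf_eq_inf_of_incomparable (hqf a b) (hqf a' c) n1 n2)
    have e1 := hlt hb.1
    have e2 := hlt hc.1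
    have h3 := hf' b c
    rw [dist_eq_rootDist, ← e] at h3
    rw [dist_eq_rootDist]
    have h4 := dist_triangle4_left a a' (b : A) c
    have h5 := dist_triangle4_right (b : A) c a a'
    rw [dist_comm (b : A) a, dist_comm (c : A) a'] at h5
    linarith
  -- `f b` itself belongs to the chain at `b`, and no member of that chain is higher.
  · have e : q b b = f b := eq_of_le_of_rootDist_le (hqf _ _) (by rw [hqd]; simp)
    refine (eq_of_le_of_rootDist_le (e ▸ hqg b b) (le_of_forall_lt fun s hs => ?_)).symm
    obtain ⟨c, hc⟩ := hg b s hs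
    exact hc.trans_le (by simpa using hbound b c b)

/-! ### Compactness and precompactness. -/

theorem isPrecompact_of_compactSpace (W : WeightedTree T) [CompactSpace (RTreeCompletion W)] : W.IsPrecompact := by
  classical
  intro ε hε
  obtain ⟨N, -, hN, hcov⟩ := finite_cover_balls_of_compact
    (isCompact_univ (X := RTreeCompletion W)) (half_pos hε)
  have hF : ∀ x : RTreeCompletion W, ∃ F : Finset T, ∀ L, Disjoint L F →
      ∑ t ∈ L, W.coord x t < ε / 2 := fun x => by
    obtain ⟨F, hF⟩ := summable_iff_vanishing_norm.1 (summable_coord x) (ε / 2) (half_pos hε)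
    exact ⟨F, fun L hL => (le_abs_self _).trans_lt (hF L hL)⟩
  choose F hF using hF
  refine ⟨hN.toFinset.biUnion F, fun L hL hLF => ?_⟩
  rcases L.eq_empty_or_nonempty with rfl | hne
  · simpa using hε
  obtain ⟨m, hm⟩ := L.exists_maximal hne
  have hle : ∀ t ∈ L, t ≤ m := fun t ht => (hL.total ht hm.1).elim id fun h => hm.2 ht h
  -- The upper end of the edge of `m` has full weight on all of `L`. A net point within `ε / 2` of
  -- it has coordinate sum less than `ε / 2` on `L`.
  obtain ⟨p, hp⟩ : ∃ p : RTreeCompletion W, ∀ t ≤ m, W.coord p t = W.weight t := by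
    refine ⟨.point ⟨m, W.weight m, ?_⟩, fun t ht => ?_⟩
    · rcases (W.weight_nonneg m).eq_or_lt with h | h
      · exact Or.inl ⟨(W.weight_eq_zero_iff m).1 h.symm, h.symm⟩
      · exact Or.inr ⟨h, le_rfl⟩
    · rcases ht.eq_or_lt with rfl | ht
      · simp [coord]
      · simp [coord, ht, ht.ne]
  obtain ⟨x, hx, hpx⟩ := Set.mem_iUnion₂.1 (hcov (Set.mem_univ p))
  rw [Metric.mem_ball] at hpx
  have h1 := hF x L (Finset.disjoint_left.2 fun t ht ht' =>
    hLF t ht (Finset.mem_biUnion.2 ⟨x, hN.mem_toFinset.2 hx, ht'⟩))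
  calc ∑ t ∈ L, W.weight t = ∑ t ∈ L, W.coord p t :=
        Finset.sum_congr rfl fun t ht => (hp t (hle t ht)).symm
    _ ≤ ∑ t ∈ L, (|W.coord p t - W.coord x t| + W.coord x t) :=
        Finset.sum_le_sum fun t _ => by linarith [le_abs_self (W.coord p t - W.coord x t)]
    _ = ∑ t ∈ L, |W.coord p t - W.coord x t| + ∑ t ∈ L, W.coord x t := Finset.sum_add_distrib
    _ < ε := by linarith [sum_abs_coord_sub_le_dist p x L]

theorem compactSpace_of_isPrecompact (W : WeightedTree T) (h : W.IsPrecompact) : CompactSpace (RTreeCompletion W) := by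
  classical
  refine ⟨TotallyBounded.isCompact_of_isClosed ?_ isClosed_univ⟩
  refine Metric.totallyBounded_of_finite_discretization fun ε hε => ?_
  obtain ⟨F, hF⟩ := h (ε / 4) (by linarith)
  -- Coordinates in `F` contribute less than `ε / 4` in total, and the two tails less than `ε / 4`
  -- each. The `+ 1` covers empty `F` and makes the bound strict.
  set δ := ε / (4 * (F.card + 1)) with hδ
  have hδ0 : 0 < δ := by positivity
  have hδF : F.card * δ < ε / 4 := by
    rw [hδ, mul_div_assoc', div_lt_div_iff₀ (by positivity) (by positivity)]
    nlinarith
  have htail : ∀ (x : RTreeCompletion W) (L : Finset T), Disjoint L F →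
      ∑ t ∈ L, W.coord x t < ε / 4 := fun x L hL => by
    -- Only positive coordinates matter, and their nodes form a chain, to which precompactness
    -- applies.
    rw [← Finset.sum_filter_of_ne (p := fun t => 0 < W.coord x t)
      fun t _ h => lt_of_le_of_ne (coord_nonneg x t) h.symm]
    refine (Finset.sum_le_sum fun t _ => coord_le_weight x t).trans_lt (hF _ ?_ ?_)
    · intro s hs t ht _
      simp only [Finset.coe_filter, Set.mem_ofPred_eq] at hs ht
      exact comparable_of_coord_pos x hs.2 ht.2
    · exact fun t ht => Finset.disjoint_left.1 hL (Finset.mem_filter.1 ht).1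
  refine ⟨(t : F) → Fin (⌊W.weight t / δ⌋₊ + 1), inferInstance, fun x t =>
    ⟨⌊W.coord x t / δ⌋₊, Nat.lt_succ_of_le (Nat.floor_le_floor
      (div_le_div_of_nonneg_right (coord_le_weight _ _) hδ0.le))⟩, ?_⟩
  rintro ⟨x, hx⟩ ⟨y, hy⟩ hxy
  have hclose : ∀ t ∈ F, |W.coord x t - W.coord y t| ≤ δ := fun t ht => by
    have h1 : ⌊W.coord x t / δ⌋₊ = ⌊W.coord y t / δ⌋₊ := congrArg Fin.val (congrFun hxy ⟨t, ht⟩)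
    have hx := Nat.floor_le (div_nonneg (coord_nonneg x t) hδ0.le)
    have hx' := Nat.lt_floor_add_one (W.coord x t / δ)
    have hy := Nat.floor_le (div_nonneg (coord_nonneg y t) hδ0.le)
    have hy' := Nat.lt_floor_add_one (W.coord y t / δ)
    rw [h1] at hx hx'
    have : |W.coord x t / δ - W.coord y t / δ| ≤ 1 := by rw [abs_le]; constructor <;> linarith
    rwa [← sub_div, abs_div, abs_of_pos hδ0, div_le_one hδ0] at this
  refine (dist_le_of_forall_sum_le (r := 3 * (ε / 4)) fun G => ?_).trans_lt (by linarith)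
  rw [← Finset.sum_inter_add_sum_sdiff G F]
  have h1 : ∑ t ∈ G ∩ F, |W.coord x t - W.coord y t| ≤ F.card * δ := by
    calc _ ≤ ∑ t ∈ F, |W.coord x t - W.coord y t| := Finset.sum_le_sum_of_subset_of_nonneg
          Finset.inter_subset_right fun _ _ _ => abs_nonneg _
      _ ≤ ∑ t ∈ F, δ := Finset.sum_le_sum hclose
      _ = F.card * δ := by simp
  have h2 : ∑ t ∈ G \ F, |W.coord x t - W.coord y t| ≤
      ∑ t ∈ G \ F, W.coord x t + ∑ t ∈ G \ F, W.coord y t := by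
    rw [← Finset.sum_add_distrib]
    refine Finset.sum_le_sum fun t _ => ?_
    have := coord_nonneg x t
    have := coord_nonneg y t
    rw [abs_le]; constructor <;> linarith
  have h3 := htail x (G \ F) Finset.sdiff_disjoint
  have h4 := htail y (G \ F) Finset.sdiff_disjoint
  linarith

/-! ### Separability and countability. -/

/-- The open edges of the nodes other than the root are nonempty, open and pairwise disjoint,
because a point beyond an edge has full weight on it. -/
theorem countable_of_separableSpace (W : WeightedTree T) [TopologicalSpace.SeparableSpace (RTreeCompletion W)] :
    Countable T := by
  set U : T → Set (RTreeCompletion W) := fun t => {x | W.coord x t ∈ Set.Ioo 0 (W.weight t)}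
  have hdisj : ∀ s t, s < t → Disjoint (U s) (U t) := fun s t hst =>
    Set.disjoint_left.2 fun x hs ht => hs.2.ne (coord_eq_weight_of_lt x hst ht.1)
  have hpair : ({W.root}ᶜ : Set T).PairwiseDisjoint U := by
    intro s _ t _ hst
    refine Set.disjoint_left.2 fun x hs ht => ?_
    rcases comparable_of_coord_pos x hs.1 ht.1 with h | h
    · exact Set.disjoint_left.1 (hdisj s t (lt_of_le_of_ne h hst)) hs ht
    · exact Set.disjoint_left.1 (hdisj t s (lt_of_le_of_ne h hst.symm)) ht hs
  have hcount := hpair.countable_of_isOpen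
    (fun t _ => isOpen_Ioo.preimage (continuous_coord t)) fun t ht => by
      have h0 : 0 < W.weight t := lt_of_le_of_ne (W.weight_nonneg t)
        fun h => ht ((W.weight_eq_zero_iff t).1 h.symm)
      refine ⟨.point ⟨t, W.weight t / 2, Or.inr ⟨by linarith, by linarith⟩⟩, ?_⟩
      change W.coord _ t ∈ Set.Ioo 0 (W.weight t)
      simp only [coord, if_true]
      exact ⟨by linarith, by linarith⟩
  refine Set.countable_univ_iff.1 ?_
  rw [← Set.compl_union_self {W.root}]
  exact hcount.union (Set.countable_singleton _)

theorem separableSpace_of_countable (W : WeightedTree T) [Countable T] :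
    TopologicalSpace.SeparableSpace (RTreeCompletion W) := by
  have : SecondCountableTopology (RTreeCompletion W) := by
    refine Metric.secondCountable_of_countable_discretization fun ε hε => ?_
    choose p hp using fun x => (denseRange_point W).exists_dist_lt x (show 0 < ε / 3 by linarith)
    -- Each point is coded by a nearby point of `T_w`, through its node and its height rounded to
    -- multiples of `ε / 3`. Equal codes leave three distances: two less than `ε / 3` and one at
    -- most `ε / 3`.
    refine ⟨T × ℕ, Encodable.ofCountable _, fun x => ((p x).node, ⌊(p x).height / (ε / 3)⌋₊),
      fun x y hxy => ?_⟩
    obtain ⟨h1, h2⟩ := Prod.mk.inj hxy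
    have hpq : dist (RTreeCompletion.point (p x)) (.point (p y)) ≤ ε / 3 := by
      change W.pointDist (p x) (p y) ≤ ε / 3
      rw [pointDist, if_pos h1]
      have h0 : 0 < ε / 3 := by linarith
      have hx := Nat.floor_le (div_nonneg (p x).height_nonneg h0.le)
      have hx' := Nat.lt_floor_add_one ((p x).height / (ε / 3))
      have hy := Nat.floor_le (div_nonneg (p y).height_nonneg h0.le)
      have hy' := Nat.lt_floor_add_one ((p y).height / (ε / 3))
      rw [h2] at hx hx'
      have : |(p x).height / (ε / 3) - (p y).height / (ε / 3)| ≤ 1 := by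
        rw [abs_le]; constructor <;> linarith
      rwa [← sub_div, abs_div, abs_of_pos h0, div_le_one h0] at this
    have h3 := dist_triangle4 x (.point (p x)) (.point (p y)) y
    have h4 := hp x
    have h5 := hp y
    rw [dist_comm] at h5
    linarith
  infer_instance

end WeightedTree

theorem corollary4 {T : Type u} [PartialOrder T] (W : WeightedTree T) :
    (CompleteSpace W.RTreeCompletion ∧
      Isometry (WeightedTree.RTreeCompletion.point : W.RTree → W.RTreeCompletion) ∧
      DenseRange (WeightedTree.RTreeCompletion.point : W.RTree → W.RTreeCompletion)) ∧
    (IsRTree W.RTreeCompletion ∧ IsInjectiveMetricSpace.{v} W.RTreeCompletion) ∧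
    (CompactSpace W.RTreeCompletion ↔ W.IsPrecompact) ∧
    (TopologicalSpace.SeparableSpace W.RTreeCompletion ↔ Countable T) :=
  ⟨⟨W.completeSpace, Isometry.of_dist_eq fun _ _ => rfl, W.denseRange_point⟩,
    ⟨W.isRTree, W.isInjectiveMetricSpace⟩,
    ⟨fun _ => W.isPrecompact_of_compactSpace, W.compactSpace_of_isPrecompact⟩,
    ⟨fun _ => W.countable_of_separableSpace, fun _ => W.separableSpace_of_countable⟩⟩
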